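/- Let $s\ge 1$ and let $\alpha=(\alpha_1,\dots,\alpha_{2s})$ be a sequence of positive integers with sum $n$; indices of the $\alpha_i$ are read cyclically modulo $2s$. The circular fence $\overline F(\alpha)$ is the poset on the nodes $x_1,\dots,x_n$, with $x_{n+1}:=x_1$, whose order is the reflexive transitive closure of the relations $$x_1\preceq x_2\preceq\cdots\preceq x_{\alpha_1+1}\succeq x_{\alpha_1+2}\succeq\cdots\succeq x_{\alpha_1+\alpha_2+1}\preceq x_{\alpha_1+\alpha_2+2}\preceq\cdots\preceq x_{\alpha_1+\alpha_2+\alpha_3+1}\succeq\cdots\succeq x_{n+1}=x_1 .$$ The $i$-th segment is the chain of the $\alpha_i+1$ nodes from $x_{\alpha_1+\cdots+\alpha_{i-1}+1}$ to $x_{\alpha_1+\cdots+\alpha_i+1}$. A node is shared if it lies on two different segments (so exactly the ends of the segments are shared), and unshared otherwise. Segments $i$ and $i+1$ meet in the node $x_{\alpha_1+\cdots+\alpha_i+1}$, said to lie between them, which is a maximal element of the poset for $i$ odd and a minimal one for $i$ even. Rowmotion is the permutation of the set of lower order ideals of $\overline F(\alpha)$ that sends $I$ to the ideal generated by the minimal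 elements of the complement of $I$. A statistic on ideals is $d$-mesic if its average over every rowmotion orbit is $d$. For an ideal $I$ and a node $x$ let $\mathcal M_x(I)=1$ if $x$ is a maximal element of $I$ and $0$ otherwise, let $\mathcal M=\sum_x\mathcal M_x$, and let $\overline\chi_x(I)=1$ if $x\in I$ and $0$ otherwise. For a rowmotion orbit $\mathcal O$ let $r_i(\mathcal O)$ be the number of ideals $I\in\mathcal O$ of which the node between segments $i$ and $i+1$ is a maximal element. (This is the number of red tiles starting in row $i$ in one period of the circular $\alpha$-tiling that represents $\mathcal O$.) Then: 1. If $x$ and $y$ are unshared elements of the same segment, then $\mathcal M_x-\mathcal M_y$ is $0$-mesic. 2. If $x$ is an unshared element of segment $i$, and $T$ and $B$ are the maximal and the minimal element of the poset that are the ends of segment $i$, then $\alpha_i\mathcal M_x+\mathcal M_T+\mathcal M_B$ is $1$-mesic. 3. Let $T$ be the maximal element lying between segments $2i+1$ and $2i+2$, and let $B$ be the minimal element lying between segments $2j$ and $2j+1$ (cyclically). If $r_{2i+1}(\mathcal O)=r_{2j}(\mathcal O)$ for all rowmotion orbits $\mathcal O$, then $\overline\chi_T+\overline\chi_B$ is $1$-mesic.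 4. If $\alpha_i=2$ for all $i$, then $\mathcal M$ is $s$-mesic. -/

import Mathlib

section Rowmotion

/-- Every element outside a lower set of a finite poset lies above a minimal such element. -/
theorem LowerSet.exists_minimal_notMem_le {P : Type*} [PartialOrder P] [Finite P]
    (I : LowerSet P) {a : P} (ha : a ∉ I) : ∃ x, x ≤ a ∧ Minimal (fun y => y ∉ I) x := by
  obtain ⟨x, hxa, hx⟩ := (Set.toFinite {y : P | y ∉ I}).exists_le_minimal ha
  exact ⟨x, hxa, hx⟩

/-- Every element of a lower set of a finite poset lies below a maximal element of it. -/
theorem LowerSet.exists_maximal_mem_ge {P : Type*} [PartialOrder P] [Finite P]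
    (I : LowerSet P) {a : P} (ha : a ∈ I) : ∃ x, a ≤ x ∧ Maximal (fun y => y ∈ I) x := by
  obtain ⟨x, hxa, hx⟩ := (Set.toFinite {y : P | y ∈ I}).exists_le_maximal ha
  exact ⟨x, hxa, hx⟩

/-- Rowmotion on the (lower) order ideals of a finite poset: the ideal `I` is sent to the ideal
generated by the minimal elements of the complement of `I`. The inverse sends `I` to the
complement of the upper set generated by the maximal elements of `I`. -/
def rowmotion (P : Type*) [PartialOrder P] [Finite P] : Equiv.Perm (LowerSet P) where
  toFun I := lowerClosure {x | Minimal (fun y => y ∉ I) x}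
  invFun I := (upperClosure {x | Maximal (fun y => y ∈ I) x}).compl
  left_inv I := by
    ext a
    simp only [UpperSet.mem_compl_iff, SetLike.mem_coe, mem_upperClosure, Set.mem_ofPred_eq]
    constructor
    · intro h
      by_contra ha
      obtain ⟨x, hxa, hx⟩ := I.exists_minimal_notMem_le ha
      refine h ⟨x, ⟨mem_lowerClosure.2 ⟨x, hx, le_rfl⟩, ?_⟩, hxa⟩
      intro y hy hxy
      obtain ⟨z, hz, hyz⟩ := mem_lowerClosure.1 hy
      exact hyz.trans (hz.2 hx.1 (hxy.trans hyz))
    · rintro ha ⟨x, hx, hxa⟩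
      obtain ⟨z, hz, hxz⟩ := mem_lowerClosure.1 hx.1
      have hzx : z ≤ x := hx.2 (mem_lowerClosure.2 ⟨z, hz, le_rfl⟩) hxz
      exact hz.1 (I.lower (hzx.trans hxa) ha)
  right_inv I := by
    ext a
    simp only [SetLike.mem_coe, mem_lowerClosure, Set.mem_ofPred_eq]
    constructor
    · rintro ⟨x, hx, hax⟩
      have h1 := hx.1
      simp only [UpperSet.mem_compl_iff, not_not, mem_upperClosure, Set.mem_ofPred_eq] at h1
      obtain ⟨z, hz, hzx⟩ := h1
      have hxz : x ≤ z := hx.2 (y := z) (by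
        simp only [UpperSet.mem_compl_iff, not_not, mem_upperClosure, Set.mem_ofPred_eq]
        exact ⟨z, hz, le_rfl⟩) hzx
      exact I.lower (hax.trans hxz) hz.1
    · intro ha
      obtain ⟨x, hax, hx⟩ := I.exists_maximal_mem_ge ha
      refine ⟨x, ⟨?_, ?_⟩, hax⟩
      · simp only [UpperSet.mem_compl_iff, not_not, mem_upperClosure, Set.mem_ofPred_eq]
        exact ⟨x, hx, le_rfl⟩
      · intro y hy hyx
        simp only [UpperSet.mem_compl_iff, not_not, mem_upperClosure, Set.mem_ofPred_eq] at hy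
        obtain ⟨z, hz, hzy⟩ := hy
        exact (hz.2 hx.1 (hzy.trans hyx)).trans hzy

variable {P : Type*} [PartialOrder P] [Fintype P]

noncomputable instance LowerSet.fintypeOfFintype : Fintype (LowerSet P) :=
  @Fintype.ofFinite _ (Finite.of_injective (fun I : LowerSet P => (I : Set P)) SetLike.coe_injective)

open Classical in
/-- The orbit of the ideal `I` under the cyclic group generated by rowmotion. -/
noncomputable def rowOrbit (I : LowerSet P) : Finset (LowerSet P) :=
  Finset.univ.filter fun J => (rowmotion P).SameCycle I J

/-- The statistic `st` on ideals is `d`-mesic (with respect to rowmotion): its average over every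
rowmotion orbit equals `d`. -/
def IsMesic (st : LowerSet P → ℚ) (d : ℚ) : Prop :=
  ∀ I : LowerSet P, (∑ J ∈ rowOrbit I, st J) / ((rowOrbit I).card : ℚ) = d

open Classical in
/-- `M_x`: its sum over an orbit is the number of times `x` occurs as a maximal element. -/
noncomputable def maxStat (x : P) (I : LowerSet P) : ℚ :=
  if Maximal (fun y => y ∈ I) x then 1 else 0

/-- `M = ∑ x, M_x`, the number of maximal elements of an ideal. -/
noncomputable def totalMaxStat (I : LowerSet P) : ℚ := ∑ x : P, maxStat x I

open Classical in
/-- `χ̄_x`: its sum over an orbit is the number of times `x` occurs. -/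
noncomputable def memStat (x : P) (I : LowerSet P) : ℚ :=
  if x ∈ I then 1 else 0

end Rowmotion

section CircularFence

/-- The node set of the circular fence of the composition `α = (α_1, …, α_{2s})`. Segments are
numbered from `0`, so segment `i` here is the one of `α_{i+1}`. The nodes `x_1, …, x_n` are listed
segment by segment: `⟨i, k⟩` is the node reached from the first node of segment `i` after `k < α_i`
steps along it, that is `x_{α_1 + ⋯ + α_i + k + 1}`. The last node of a segment is the first node
of the cyclically next one. -/
@[ext]
structure CircularFence {s : ℕ} (α : Fin (2 * s) → ℕ+) where
  seg : Fin (2 * s)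
  pos : Fin (α seg : ℕ)

namespace CircularFence

/-- The cyclically next segment. -/
def nextSeg {s : ℕ} (i : Fin (2 * s)) : Fin (2 * s) :=
  ⟨(i.val + 1) % (2 * s), Nat.mod_lt _ (Nat.zero_lt_of_lt i.isLt)⟩

variable {s : ℕ} {α : Fin (2 * s) → ℕ+}

instance : Fintype (CircularFence α) :=
  Fintype.ofEquiv (Σ i : Fin (2 * s), Fin (α i : ℕ))
    { toFun := fun x => ⟨x.1, x.2⟩
      invFun := fun x => ⟨x.seg, x.pos⟩
      left_inv := fun _ => rfl
      right_inv := fun _ => rfl }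

/-- The first node of segment `i`. -/
def first (α : Fin (2 * s) → ℕ+) (i : Fin (2 * s)) : CircularFence α := ⟨i, ⟨0, (α i).pos⟩⟩

/-- The node following `x` on the circle: from `x_t` to `x_{t+1}`, where `x_{n+1} = x_1`. -/
def next (x : CircularFence α) : CircularFence α :=
  if h : x.pos.val + 1 < (α x.seg : ℕ) then ⟨x.seg, ⟨x.pos.val + 1, h⟩⟩
  else first α (nextSeg x.seg)

/-- The defining relations. Segments number `0, 2, 4, …` go up (`x_t ≼ x_{t+1}`), segments number
`1, 3, 5, …` go down (`x_{t+1} ≼ x_t`). -/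
inductive Step : CircularFence α → CircularFence α → Prop
  | up (x : CircularFence α) (hx : Even x.seg.val) : Step x x.next
  | down (x : CircularFence α) (hx : Odd x.seg.val) : Step x.next x

/-- An auxiliary height that increases along the defining relations. -/
def height (x : CircularFence α) : ℕ :=
  if Even x.seg.val then x.pos.val else (∑ i, (α i : ℕ)) - x.pos.val

theorem even_nextSeg (i : Fin (2 * s)) : Even (nextSeg i).val ↔ Odd i.val := by
  have h : (i.val + 1) % (2 * s) % 2 = (i.val + 1) % 2 :=
    Nat.mod_mod_of_dvd _ (Dvd.intro _ rfl)
  simp only [nextSeg, Nat.even_iff, Nat.odd_iff, h]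
  omega

theorem Step.height_lt {x y : CircularFence α} (h : Step x y) : x.height < y.height := by
  have key : ∀ z : CircularFence α, z.pos.val < ∑ i, (α i : ℕ) := fun z =>
    z.pos.isLt.trans_le
      (Finset.single_le_sum (f := fun i => (α i : ℕ)) (fun _ _ => Nat.zero_le _)
        (Finset.mem_univ z.seg))
  cases h with
  | up x hx =>
    have hk := key x
    unfold next
    split_ifs with h
    · simp [height, hx]
    · have h2 : ¬ Even (nextSeg x.seg).val := by
        rw [even_nextSeg]; exact Nat.not_odd_iff_even.2 hx
      simp only [height, first, hx, h2, if_true, if_false]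
      omega
  | down x hx =>
    have hk := key y
    unfold next
    have hx' : ¬ Even y.seg.val := Nat.not_even_iff_odd.2 hx
    split_ifs with h
    · simp only [height, hx', if_false]
      omega
    · have h2 : Even (nextSeg y.seg).val := (even_nextSeg _).2 hx
      simp only [height, first, hx', h2, if_true, if_false]
      omega

/-- The order of the circular fence: the reflexive transitive closure of the defining relations. -/
instance : PartialOrder (CircularFence α) where
  le := Relation.ReflTransGen Step
  le_refl _ := Relation.ReflTransGen.refl
  le_trans _ _ _ := Relation.ReflTransGen.trans
  le_antisymm x y hxy hyx := by
    have mono : ∀ a b : CircularFence α, Relation.ReflTransGen Step a b →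
        a = b ∨ a.height < b.height := by
      intro a b h
      induction h with
      | refl => exact Or.inl rfl
      | tail _ hs ih =>
        rcases ih with rfl | ih
        · exact Or.inr hs.height_lt
        · exact Or.inr (ih.trans hs.height_lt)
    rcases mono x y hxy with h | h
    · exact h
    · rcases mono y x hyx with h' | h'
      · exact h'.symm
      · omega

/-- The nodes of the `i`-th segment, a chain of `α_i + 1` nodes including both of its ends. -/
def segment (α : Fin (2 * s) → ℕ+) (i : Fin (2 * s)) : Set (CircularFence α) :=
  {x | x.seg = i ∨ x = first α (nextSeg i)}

/-- A node is shared if it lies on two different segments. -/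
def IsShared (x : CircularFence α) : Prop :=
  ∃ i j : Fin (2 * s), i ≠ j ∧ x ∈ segment α i ∧ x ∈ segment α j

/-- In the column that represents the ideal `I`, there is a red tile starting in row `i` (covering
the rows of segments `i` and `i + 1`, cyclically) when the node at which segment `i` ends and the
next segment begins is a maximal element of `I`. -/
def HasRedTile (I : LowerSet (CircularFence α)) (i : Fin (2 * s)) : Prop :=
  Maximal (fun y => y ∈ I) (first α (nextSeg i))

open Classical in
/-- `r_i`: the number of red tiles starting in row `i` in one period of the tiling that represents
the rowmotion orbit of `I`, the columns of a period being the ideals of the orbit. -/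
noncomputable def redCount (i : Fin (2 * s)) (I : LowerSet (CircularFence α)) : ℕ :=
  ((rowOrbit I).filter fun J => HasRedTile J i).card

end CircularFence

end CircularFence

/-! ### Orbit sums and the local rules for rowmotion -/

section RowmotionOrbits

/-! Orbit sums do not change when a statistic is precomposed with rowmotion, and the maximal
elements of the image of `I` are the minimal elements of the complement of `I`. Hence `M_x` can be
computed in two ways: an `x` with unique upper cover `y` has `M_x = χ̄_x - χ̄_y`, and an `x` with
unique lower cover `y` has `M_x = χ̄_y - χ̄_x` after rowmotion.

An unshared node of a segment has both covers, each on the segment. Comparing the two formulas, the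
orbit sums of `χ̄` form an arithmetic progression along the segment, whose common drop is the orbit
sum of `M_x` at every unshared node. This is (1). The ends satisfy `M_T = χ̄_T` and, after
rowmotion, `M_B = 1 - χ̄_B`. Since the total drop from `B` to `T` is `α_i` times the common one, (2)
follows.

The same two end formulas turn equality of the orbit sums of `M_T` and `M_B` into (3). For (4), sum
(2) over all segments: each middle node has coefficient 2, and each shared node is an end of two
segments, so the orbit sum of `2 * M` is `2 * s` times the size of the orbit. -/

theorem maxStat_of_isMax {P : Type*} [PartialOrder P] {x : P} (hx : IsMax x) (I : LowerSet P) :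
    maxStat x I = memStat x I := by
  have h : Maximal (fun y => y ∈ I) x ↔ x ∈ I :=
    ⟨fun h => h.1, fun h => ⟨h, fun _ _ hxy => hx hxy⟩⟩
  by_cases hI : x ∈ I <;> simp [maxStat, memStat, h, hI]

/-- If `y` is the unique upper cover of `x`, then `M_x = χ̄_x - χ̄_y`. -/
theorem maxStat_eq_sub {P : Type*} [PartialOrder P] {x y : P} (hxy : x < y)
    (hy : ∀ z, x < z → y ≤ z) (I : LowerSet P) :
    maxStat x I = memStat x I - memStat y I := by
  have h : Maximal (fun z => z ∈ I) x ↔ x ∈ I ∧ y ∉ I := by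
    refine ⟨fun h => ⟨h.1, fun hyI => hxy.not_ge (h.2 hyI hxy.le)⟩, fun h => ⟨h.1, ?_⟩⟩
    intro z hz hxz
    by_contra hzx
    exact h.2 (I.lower (hy z (lt_of_le_not_ge hxz hzx)) hz)
  have hI : y ∈ I → x ∈ I := fun h => I.lower hxy.le h
  by_cases h1 : x ∈ I <;> by_cases h2 : y ∈ I <;> simp_all [maxStat, memStat]

variable {P : Type*} [PartialOrder P] [Fintype P]

theorem mem_rowOrbit {I J : LowerSet P} : J ∈ rowOrbit I ↔ (rowmotion P).SameCycle I J := by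
  simp [rowOrbit]

theorem card_rowOrbit_ne_zero (I : LowerSet P) : ((rowOrbit I).card : ℚ) ≠ 0 :=
  Nat.cast_ne_zero.2 (Finset.card_ne_zero_of_mem (mem_rowOrbit.2 (Equiv.Perm.SameCycle.refl _ I)))

/-- The sum of a statistic over a rowmotion orbit is unchanged by precomposing with rowmotion. -/
theorem sum_rowOrbit_rowmotion (st : LowerSet P → ℚ) (I : LowerSet P) :
    ∑ J ∈ rowOrbit I, st (rowmotion P J) = ∑ J ∈ rowOrbit I, st J :=
  Finset.sum_equiv (rowmotion P)
    (fun J => by rw [mem_rowOrbit, mem_rowOrbit, Equiv.Perm.sameCycle_apply_right])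
    (fun _ _ => rfl)

theorem isMesic_of_sum_eq {st : LowerSet P → ℚ} {d : ℚ}
    (h : ∀ I : LowerSet P, ∑ J ∈ rowOrbit I, st J = d * (rowOrbit I).card) : IsMesic st d :=
  fun I => by rw [h I, mul_div_cancel_right₀ _ (card_rowOrbit_ne_zero I)]

/-- The minimal elements of the complement form an antichain, and an ideal generated by an antichain
has exactly that antichain as its maximal elements. -/
theorem maximal_mem_rowmotion_iff (I : LowerSet P) (x : P) :
    Maximal (fun y => y ∈ rowmotion P I) x ↔ Minimal (fun y => y ∉ I) x := by
  have hmem : ∀ y, y ∈ rowmotion P I ↔ ∃ z, Minimal (fun y => y ∉ I) z ∧ y ≤ z := fun y =>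
    mem_lowerClosure
  constructor
  · intro h
    obtain ⟨z, hz, hxz⟩ := (hmem x).1 h.1
    rwa [le_antisymm hxz (h.2 ((hmem z).2 ⟨z, hz, le_rfl⟩) hxz)]
  · intro h
    refine ⟨(hmem x).2 ⟨x, h, le_rfl⟩, fun y hy hxy => ?_⟩
    obtain ⟨z, hz, hyz⟩ := (hmem y).1 hy
    exact hyz.trans (hz.2 h.1 (hxy.trans hyz))

theorem maxStat_rowmotion_of_isMin {x : P} (hx : IsMin x) (I : LowerSet P) :
    maxStat x (rowmotion P I) = 1 - memStat x I := by
  have h : Maximal (fun y => y ∈ rowmotion P I) x ↔ x ∉ I :=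
    (maximal_mem_rowmotion_iff I x).trans ⟨fun h => h.1, fun h => ⟨h, fun _ _ hxy => hx hxy⟩⟩
  by_cases hI : x ∈ I <;> simp [maxStat, memStat, h, hI]

/-- If `y` is the unique lower cover of `x`, then `M_x` after rowmotion is `χ̄_y - χ̄_x`. -/
theorem maxStat_rowmotion_eq_sub {x y : P} (hyx : y < x) (hy : ∀ z, z < x → z ≤ y)
    (I : LowerSet P) : maxStat x (rowmotion P I) = memStat y I - memStat x I := by
  have h : Maximal (fun z => z ∈ rowmotion P I) x ↔ x ∉ I ∧ y ∈ I := by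
    rw [maximal_mem_rowmotion_iff]
    refine ⟨fun h => ⟨h.1, ?_⟩, fun h => ⟨h.1, ?_⟩⟩
    · by_contra hyI
      exact hyx.not_ge (h.2 hyI hyx.le)
    · intro z hz hzx
      by_contra hxz
      exact hz (I.lower (hy z (lt_of_le_not_ge hzx hxz)) h.2)
  have hI : x ∈ I → y ∈ I := fun h => I.lower hyx.le h
  by_cases h1 : x ∈ I <;> by_cases h2 : y ∈ I <;> simp_all [maxStat, memStat]

/-! ### Arithmetic progressions along unbranched chains -/

/-- A chain `c 0 < ⋯ < c a` from a minimal to a maximal element whose inner elements have no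
covers outside the chain. -/
structure IsUnbranchedChain (c : ℕ → P) (a : ℕ) : Prop where
  lt_succ : ∀ k, k < a → c k < c (k + 1)
  succ_le : ∀ k, 0 < k → k < a → ∀ y, c k < y → c (k + 1) ≤ y
  le_pred : ∀ k, k + 1 < a → ∀ y, y < c (k + 1) → y ≤ c k
  isMin : IsMin (c 0)
  isMax : IsMax (c a)

namespace IsUnbranchedChain

variable {c : ℕ → P} {a : ℕ}

theorem sum_maxStat (h : IsUnbranchedChain c a) {k : ℕ} (hk : 0 < k) (hka : k < a)
    (I : LowerSet P) :
    ∑ J ∈ rowOrbit I, maxStat (c k) J =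
      ∑ J ∈ rowOrbit I, memStat (c k) J - ∑ J ∈ rowOrbit I, memStat (c (k + 1)) J := by
  rw [← Finset.sum_sub_distrib]
  exact Finset.sum_congr rfl fun J _ => maxStat_eq_sub (h.lt_succ k hka) (h.succ_le k hk hka) J

theorem sum_maxStat_succ (h : IsUnbranchedChain c a) {k : ℕ} (hka : k + 1 < a)
    (I : LowerSet P) :
    ∑ J ∈ rowOrbit I, maxStat (c (k + 1)) J =
      ∑ J ∈ rowOrbit I, memStat (c k) J - ∑ J ∈ rowOrbit I, memStat (c (k + 1)) J := by
  -- Shifting the left-hand sum by rowmotion makes the lower-cover formula applicable.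
  rw [← Finset.sum_sub_distrib, ← sum_rowOrbit_rowmotion]
  exact Finset.sum_congr rfl fun J _ =>
    maxStat_rowmotion_eq_sub (h.lt_succ k (by omega)) (h.le_pred k hka) J

/-- The drops just below and just above an inner element both equal its orbit sum of `M`, so all
drops agree. -/
theorem sum_memStat_sub (h : IsUnbranchedChain c a) (I : LowerSet P) {k : ℕ} (hk : k < a) :
    ∑ J ∈ rowOrbit I, memStat (c k) J - ∑ J ∈ rowOrbit I, memStat (c (k + 1)) J =
      ∑ J ∈ rowOrbit I, memStat (c 0) J - ∑ J ∈ rowOrbit I, memStat (c 1) J := by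
  induction k with
  | zero => rfl
  | succ k ih =>
    rw [← ih (by omega), ← h.sum_maxStat (Nat.succ_pos k) hk, h.sum_maxStat_succ hk]

theorem sum_memStat_zero_sub (h : IsUnbranchedChain c a) (I : LowerSet P) {k : ℕ} (hk : k ≤ a) :
    ∑ J ∈ rowOrbit I, memStat (c 0) J - ∑ J ∈ rowOrbit I, memStat (c k) J =
      k * (∑ J ∈ rowOrbit I, memStat (c 0) J - ∑ J ∈ rowOrbit I, memStat (c 1) J) := by
  induction k with
  | zero => simp
  | succ k ih =>
    have h1 := ih (by omega)
    have h2 := h.sum_memStat_sub I hk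
    push_cast
    linarith

/-- All inner elements of an unbranched chain are equally often maximal in an orbit. -/
theorem sum_maxStat_eq (h : IsUnbranchedChain c a) {k l : ℕ} (hk : 0 < k) (hka : k < a)
    (hl : 0 < l) (hla : l < a) (I : LowerSet P) :
    ∑ J ∈ rowOrbit I, maxStat (c k) J = ∑ J ∈ rowOrbit I, maxStat (c l) J := by
  rw [h.sum_maxStat hk hka, h.sum_maxStat hl hla, h.sum_memStat_sub I hka, h.sum_memStat_sub I hla]

/-- The total drop of `χ̄` is `a` times the drop at `c k`; the end formulas express the same total
through `M` at the two ends. -/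
theorem sum_maxStat_ends (h : IsUnbranchedChain c a) {k : ℕ} (hk : 0 < k) (hka : k < a)
    (I : LowerSet P) :
    a * ∑ J ∈ rowOrbit I, maxStat (c k) J + ∑ J ∈ rowOrbit I, maxStat (c a) J +
      ∑ J ∈ rowOrbit I, maxStat (c 0) J = (rowOrbit I).card := by
  have h1 := h.sum_memStat_zero_sub I le_rfl
  have hT : ∑ J ∈ rowOrbit I, maxStat (c a) J = ∑ J ∈ rowOrbit I, memStat (c a) J :=
    Finset.sum_congr rfl fun J _ => maxStat_of_isMax h.isMax J
  have hB : ∑ J ∈ rowOrbit I, maxStat (c 0) J =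
      (rowOrbit I).card - ∑ J ∈ rowOrbit I, memStat (c 0) J := by
    rw [← sum_rowOrbit_rowmotion,
      Finset.sum_congr rfl fun J _ => maxStat_rowmotion_of_isMin h.isMin J]
    simp
  rw [h.sum_maxStat hk hka, h.sum_memStat_sub I hka, ← h1, hT, hB]
  ring

end IsUnbranchedChain

end RowmotionOrbits

/-! ### Neighbours in the circular fence -/

namespace CircularFence

variable {s : ℕ} {α : Fin (2 * s) → ℕ+}

theorem odd_nextSeg (i : Fin (2 * s)) : Odd (nextSeg i).val ↔ Even i.val := by
  rw [← Nat.not_even_iff_odd, even_nextSeg, Nat.not_odd_iff_even]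

/-- The number of segments is even, so `nextSeg` flips parity, also when it wraps around. -/
theorem nextSeg_ne (i : Fin (2 * s)) : nextSeg i ≠ i := by
  intro h
  have h1 := even_nextSeg i
  rw [h, ← Nat.not_even_iff_odd] at h1
  tauto

theorem nextSeg_injective : Function.Injective (nextSeg (s := s)) := by
  intro i j h
  have h1 : (i.val + 1) ≡ (j.val + 1) [MOD 2 * s] := congrArg Fin.val h
  exact Fin.ext ((Nat.ModEq.add_right_cancel' 1 h1).eq_of_lt_of_lt i.isLt j.isLt)

theorem nextSeg_bijective : Function.Bijective (nextSeg (s := s)) :=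
  Finite.injective_iff_bijective.1 nextSeg_injective

theorem Step.lt {x y : CircularFence α} (h : Step x y) : x < y :=
  lt_of_le_of_ne (Relation.ReflTransGen.single h) fun e => by
    have := h.height_lt
    rw [e] at this
    exact this.false

theorem exists_step_of_lt {x y : CircularFence α} (h : x < y) : ∃ z, Step x z ∧ z ≤ y := by
  rcases Relation.ReflTransGen.cases_head (show Relation.ReflTransGen Step x y from h.le) with e | e
  · exact absurd e h.ne
  · exact e

theorem exists_step_of_gt {x y : CircularFence α} (h : x < y) : ∃ z, x ≤ z ∧ Step z y := by
  rcases Relation.ReflTransGen.cases_tail (show Relation.ReflTransGen Step x y from h.le) with e | e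
  · exact absurd e.symm h.ne
  · exact e

/-- The node reached after `k` steps along segment `i`; the last one starts the next segment. -/
def node (α : Fin (2 * s) → ℕ+) (i : Fin (2 * s)) (k : ℕ) : CircularFence α :=
  if h : k < (α i : ℕ) then ⟨i, ⟨k, h⟩⟩ else first α (nextSeg i)

theorem node_zero (i : Fin (2 * s)) : node α i 0 = first α i := by
  simp [node, first]

theorem node_last (i : Fin (2 * s)) : node α i (α i : ℕ) = first α (nextSeg i) := by
  simp [node]

theorem seg_node {i : Fin (2 * s)} {k : ℕ} (h : k < (α i : ℕ)) : (node α i k).seg = i := by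
  simp [node, h]

theorem next_node {i : Fin (2 * s)} {k : ℕ} (h : k < (α i : ℕ)) :
    (node α i k).next = node α i (k + 1) := by
  have h1 : node α i k = ⟨i, ⟨k, h⟩⟩ := dif_pos h
  rw [h1]
  rfl

theorem exists_eq_node (x : CircularFence α) :
    ∃ k, k < (α x.seg : ℕ) ∧ x = node α x.seg k :=
  ⟨x.pos, x.pos.isLt, by simp [node]⟩

/-- A step that leaves its segment lands at position 0, so a node at a positive position is entered
only from within its own segment. This is why inner nodes have no covers off the segment. -/
theorem eq_node_of_next_eq {i : Fin (2 * s)} {k : ℕ} (hk : k + 1 < (α i : ℕ))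
    {y : CircularFence α} (h : y.next = node α i (k + 1)) : y = node α i k := by
  obtain ⟨l, hl, hy⟩ := exists_eq_node y
  have hseg : y.seg = i ∧ l + 1 = k + 1 := by
    rw [hy, next_node hl, node, node, dif_pos hk] at h
    split_ifs at h with h1
    · have h2 := congrArg CircularFence.seg h
      have h3 := congrArg (fun z : CircularFence α => z.pos.val) h
      exact ⟨h2, h3⟩
    · have h3 := congrArg (fun z : CircularFence α => z.pos.val) h
      simp [first] at h3
  rw [hy, hseg.1, Nat.succ_injective hseg.2]

theorem seg_of_next_eq_first {i : Fin (2 * s)} {y : CircularFence α} (h : y.next = first α i) :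
    nextSeg y.seg = i := by
  unfold next at h
  split_ifs at h with h1
  · have h3 := congrArg (fun z : CircularFence α => z.pos.val) h
    simp [first] at h3
  · exact congrArg CircularFence.seg h

theorem odd_seg_of_isMax {x : CircularFence α} (hx : IsMax x) : Odd x.seg.val := by
  rw [← Nat.not_even_iff_odd]
  exact fun h => hx.not_lt (Step.up x h).lt

theorem even_seg_of_isMin {x : CircularFence α} (hx : IsMin x) : Even x.seg.val := by
  rw [← Nat.not_odd_iff_even]
  exact fun h => hx.not_lt (Step.down x h).lt

/-- A step into this node from below would either arrive along an upward preceding segment or come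
from a downward segment starting here; parity excludes both. -/
theorem isMin_first {i : Fin (2 * s)} (hi : Even i.val) : IsMin (first α i) := by
  rw [isMin_iff_forall_not_lt]
  intro y hy
  obtain ⟨z, -, hz⟩ := exists_step_of_gt hy
  generalize hw : first α i = w at hz
  cases hz with
  | up _ h =>
    rw [← seg_of_next_eq_first hw.symm, even_nextSeg] at hi
    exact Nat.not_even_iff_odd.2 hi h
  | down _ h =>
    rw [← hw] at h
    exact Nat.not_even_iff_odd.2 h hi

theorem isMax_first {i : Fin (2 * s)} (hi : Odd i.val) : IsMax (first α i) := by
  rw [isMax_iff_forall_not_lt]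
  intro y hy
  obtain ⟨z, hz, -⟩ := exists_step_of_lt hy
  generalize hw : first α i = w at hz
  cases hz with
  | up _ h =>
    rw [← hw] at h
    exact Nat.not_even_iff_odd.2 hi h
  | down _ h =>
    rw [← seg_of_next_eq_first hw.symm, odd_nextSeg] at hi
    exact Nat.not_even_iff_odd.2 h hi

theorem isUnbranchedChain_node {i : Fin (2 * s)} (hi : Even i.val) :
    IsUnbranchedChain (node α i) (α i : ℕ) where
  lt_succ k hk := by
    rw [← next_node hk]
    exact (Step.up _ (by rwa [seg_node hk])).lt
  succ_le k hk hka y hy := by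
    obtain ⟨z, hz, hzy⟩ := exists_step_of_lt hy
    obtain ⟨k, rfl⟩ := Nat.exists_eq_add_one.2 hk
    generalize hw : node α i (k + 1) = w at hz
    cases hz with
    | up => rwa [← hw, next_node hka] at hzy
    | down _ h =>
      rw [eq_node_of_next_eq hka hw.symm, seg_node (by omega)] at h
      exact absurd hi (Nat.not_even_iff_odd.2 h)
  le_pred k hka y hy := by
    obtain ⟨z, hyz, hz⟩ := exists_step_of_gt hy
    generalize hw : node α i (k + 1) = w at hz
    cases hz with
    | up => rwa [eq_node_of_next_eq hka hw.symm] at hyz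
    | down _ h =>
      rw [← hw, seg_node hka] at h
      exact absurd hi (Nat.not_even_iff_odd.2 h)
  isMin := by
    rw [node_zero]
    exact isMin_first hi
  isMax := by
    rw [node_last]
    exact isMax_first ((odd_nextSeg i).2 hi)

/-- A downward segment is read backwards, from the first node of the next segment up to its own
first node. -/
theorem isUnbranchedChain_node_sub {i : Fin (2 * s)} (hi : Odd i.val) :
    IsUnbranchedChain (fun k => node α i ((α i : ℕ) - k)) (α i : ℕ) where
  lt_succ k hk := by
    have h : (α i : ℕ) - k = ((α i : ℕ) - (k + 1)) + 1 := by omega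
    simp only [h]
    rw [← next_node (by omega)]
    exact (Step.down _ (by rwa [seg_node (by omega)])).lt
  succ_le k hk hka y hy := by
    obtain ⟨z, hz, hzy⟩ := exists_step_of_lt hy
    have h : (α i : ℕ) - k = ((α i : ℕ) - (k + 1)) + 1 := by omega
    simp only [h] at hz
    generalize hw : node α i ((α i : ℕ) - (k + 1) + 1) = w at hz
    cases hz with
    | up _ h' =>
      rw [← hw, seg_node (by omega)] at h'
      exact absurd h' (Nat.not_even_iff_odd.2 hi)
    | down => rwa [eq_node_of_next_eq (by omega) hw.symm] at hzy
  le_pred k hka y hy := by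
    obtain ⟨z, hyz, hz⟩ := exists_step_of_gt hy
    have h : (α i : ℕ) - k = ((α i : ℕ) - (k + 1)) + 1 := by omega
    simp only [h]
    obtain ⟨m, hm⟩ : ∃ m, (α i : ℕ) - (k + 1) = m + 1 := ⟨(α i : ℕ) - (k + 1) - 1, by omega⟩
    simp only [hm] at hz ⊢
    generalize hw : node α i (m + 1) = w at hz
    cases hz with
    | up _ h' =>
      rw [eq_node_of_next_eq (by omega) hw.symm, seg_node (by omega)] at h'
      exact absurd h' (Nat.not_even_iff_odd.2 hi)
    | down => rwa [← hw, next_node (by omega)] at hyz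
  isMin := by
    simp only [Nat.sub_zero, node_last]
    exact isMin_first ((even_nextSeg i).2 hi)
  isMax := by
    simp only [Nat.sub_self, node_zero]
    exact isMax_first hi

/-! ### Segments as chains and their shared ends -/

/-- The nodes of segment `i` in increasing order. -/
def chain (α : Fin (2 * s) → ℕ+) (i : Fin (2 * s)) (k : ℕ) : CircularFence α :=
  if Even i.val then node α i k else node α i ((α i : ℕ) - k)

theorem isUnbranchedChain_chain (i : Fin (2 * s)) :
    IsUnbranchedChain (chain α i) (α i : ℕ) := by
  by_cases hi : Even i.val
  · have h : chain α i = node α i := by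
      funext k
      simp [chain, hi]
    rw [h]
    exact isUnbranchedChain_node hi
  · have h : chain α i = fun k => node α i ((α i : ℕ) - k) := by
      funext k
      simp [chain, hi]
    rw [h]
    exact isUnbranchedChain_node_sub (Nat.not_even_iff_odd.1 hi)

theorem exists_eq_chain {i : Fin (2 * s)} {x : CircularFence α} (hx : x ∈ segment α i) :
    ∃ k, k ≤ (α i : ℕ) ∧ x = chain α i k := by
  obtain ⟨k, hk, rfl⟩ : ∃ k, k ≤ (α i : ℕ) ∧ x = node α i k := by
    rcases hx with rfl | rfl
    · obtain ⟨k, hk, h⟩ := exists_eq_node x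
      exact ⟨k, hk.le, h⟩
    · exact ⟨α i, le_rfl, (node_last i).symm⟩
  by_cases hi : Even i.val
  · exact ⟨k, hk, by simp [chain, hi]⟩
  · exact ⟨(α i : ℕ) - k, by omega, by simp [chain, hi, Nat.sub_sub_self hk]⟩

theorem isShared_first (i : Fin (2 * s)) : (first α i).IsShared := by
  -- The preceding segment `j` ends at the node where `i` begins.
  obtain ⟨j, rfl⟩ := nextSeg_bijective.2 i
  exact ⟨j, nextSeg j, (nextSeg_ne j).symm, Or.inr rfl, Or.inl rfl⟩

theorem isShared_chain_zero (i : Fin (2 * s)) : (chain α i 0).IsShared := by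
  unfold chain
  split_ifs
  · rw [node_zero]
    exact isShared_first i
  · rw [Nat.sub_zero, node_last]
    exact isShared_first _

theorem isShared_chain_last (i : Fin (2 * s)) : (chain α i (α i : ℕ)).IsShared := by
  unfold chain
  split_ifs
  · rw [node_last]
    exact isShared_first _
  · rw [Nat.sub_self, node_zero]
    exact isShared_first i

theorem exists_eq_chain_of_not_isShared {i : Fin (2 * s)} {x : CircularFence α}
    (hx : x ∈ segment α i) (hs : ¬ x.IsShared) :
    ∃ k, 0 < k ∧ k < (α i : ℕ) ∧ x = chain α i k := by
  obtain ⟨k, hk, rfl⟩ := exists_eq_chain hx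
  refine ⟨k, Nat.pos_of_ne_zero ?_, lt_of_le_of_ne hk ?_, rfl⟩
  · rintro rfl
    exact hs (isShared_chain_zero i)
  · rintro rfl
    exact hs (isShared_chain_last i)

theorem eq_chain_last_of_isMax {i : Fin (2 * s)} {x : CircularFence α} (hx : x ∈ segment α i)
    (h : IsMax x) : x = chain α i (α i : ℕ) := by
  obtain ⟨k, hk, rfl⟩ := exists_eq_chain hx
  rcases hk.lt_or_eq with hk | rfl
  · exact absurd ((isUnbranchedChain_chain i).lt_succ k hk) h.not_lt
  · rfl

theorem eq_chain_zero_of_isMin {i : Fin (2 * s)} {x : CircularFence α} (hx : x ∈ segment α i)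
    (h : IsMin x) : x = chain α i 0 := by
  obtain ⟨k, hk, rfl⟩ := exists_eq_chain hx
  cases k with
  | zero => rfl
  | succ k => exact absurd ((isUnbranchedChain_chain i).lt_succ k hk) h.not_lt

/-- The relation is symmetric in the two ends, so the direction of the segment no longer matters and
it can be summed over all segments. -/
theorem sum_maxStat_segment {i : Fin (2 * s)} {k : ℕ} (hk : 0 < k) (hka : k < (α i : ℕ))
    (I : LowerSet (CircularFence α)) :
    (α i : ℕ) * ∑ J ∈ rowOrbit I, maxStat (node α i k) J +
      ∑ J ∈ rowOrbit I, maxStat (first α i) J +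
      ∑ J ∈ rowOrbit I, maxStat (first α (nextSeg i)) J = (rowOrbit I).card := by
  by_cases hi : Even i.val
  · have h := (isUnbranchedChain_node (α := α) hi).sum_maxStat_ends hk hka I
    rw [node_zero, node_last] at h
    rw [← h]
    ring
  · have h := (isUnbranchedChain_node_sub (α := α) (Nat.not_even_iff_odd.1 hi)).sum_maxStat_ends
      (k := (α i : ℕ) - k) (by omega) (by omega) I
    simp only [Nat.sub_zero, Nat.sub_self, node_zero, node_last, Nat.sub_sub_self hka.le] at h
    exact h

/-! ### Totals over all nodes -/

theorem sum_eq_sum_sum_node (f : CircularFence α → ℚ) :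
    ∑ x, f x = ∑ i, ∑ k ∈ Finset.range (α i : ℕ), f (node α i k) := by
  let e : (Σ i : Fin (2 * s), Fin (α i : ℕ)) ≃ CircularFence α :=
    { toFun := fun x => ⟨x.1, x.2⟩
      invFun := fun x => ⟨x.seg, x.pos⟩
      left_inv := fun _ => rfl
      right_inv := fun _ => rfl }
  rw [← Equiv.sum_comp e, Fintype.sum_sigma]
  refine Finset.sum_congr rfl fun i _ => ?_
  rw [Finset.sum_range]
  refine Finset.sum_congr rfl fun k _ => ?_
  simp [e, node]

theorem sum_totalMaxStat (hα : ∀ i, α i = 2) (I : LowerSet (CircularFence α)) :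
    ∑ J ∈ rowOrbit I, totalMaxStat J = s * (rowOrbit I).card := by
  have h1 : ∑ J ∈ rowOrbit I, totalMaxStat J =
      ∑ i, (∑ J ∈ rowOrbit I, maxStat (first α i) J +
        ∑ J ∈ rowOrbit I, maxStat (node α i 1) J) := by
    unfold totalMaxStat
    rw [Finset.sum_comm, sum_eq_sum_sum_node]
    refine Finset.sum_congr rfl fun i _ => ?_
    rw [hα i, show ((2 : ℕ+) : ℕ) = 2 from rfl, Finset.sum_range_succ, Finset.sum_range_one,
      node_zero]
  -- Every shared node ends one segment and begins one, so both sums run over the same nodes.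
  have h2 : ∑ i : Fin (2 * s), ∑ J ∈ rowOrbit I, maxStat (first α (nextSeg i)) J =
      ∑ i : Fin (2 * s), ∑ J ∈ rowOrbit I, maxStat (first α i) J :=
    nextSeg_bijective.sum_comp fun i => ∑ J ∈ rowOrbit I, maxStat (first α i) J
  have h3 : ∑ i : Fin (2 * s), (2 * ∑ J ∈ rowOrbit I, maxStat (node α i 1) J +
      ∑ J ∈ rowOrbit I, maxStat (first α i) J +
      ∑ J ∈ rowOrbit I, maxStat (first α (nextSeg i)) J) =
      ∑ _i : Fin (2 * s), ((rowOrbit I).card : ℚ) := by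
    refine Finset.sum_congr rfl fun i _ => ?_
    have hi : (α i : ℕ) = 2 := by rw [hα i]; rfl
    have h := sum_maxStat_segment (k := 1) one_pos (by omega) I (i := i)
    rw [hi] at h
    exact_mod_cast h
  rw [Finset.sum_add_distrib, Finset.sum_add_distrib, h2, ← Finset.mul_sum, Finset.sum_const,
    Finset.card_univ, Fintype.card_fin, nsmul_eq_mul] at h3
  rw [h1, Finset.sum_add_distrib]
  push_cast at h3
  linarith

theorem redCount_eq_sum (i : Fin (2 * s)) (I : LowerSet (CircularFence α)) :
    (redCount i I : ℚ) = ∑ J ∈ rowOrbit I, maxStat (first α (nextSeg i)) J := by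
  unfold redCount HasRedTile maxStat
  rw [Finset.sum_boole]

end CircularFence

open CircularFence in
theorem mainTheorem7 (s : ℕ) (hs : 1 ≤ s) (α : Fin (2 * s) → ℕ+) :
    -- (1) unshared elements of the same segment
    (∀ (i : Fin (2 * s)) (x y : CircularFence α),
      x ∈ CircularFence.segment α i → y ∈ CircularFence.segment α i →
      ¬ x.IsShared → ¬ y.IsShared →
      IsMesic (fun I => maxStat x I - maxStat y I) 0) ∧
    -- (2) an unshared element of segment `i`, whose ends are `T` and `B`
    (∀ (i : Fin (2 * s)) (x T B : CircularFence α),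
      x ∈ CircularFence.segment α i → ¬ x.IsShared →
      T ∈ CircularFence.segment α i → IsMax T →
      B ∈ CircularFence.segment α i → IsMin B →
      IsMesic (fun I => ((α i : ℕ) : ℚ) * maxStat x I + maxStat T I + maxStat B I) 1) ∧
    -- (3) a maximal `T` between segments `i`, `i + 1` and a minimal `B` between `j`, `j + 1`
    (∀ (i j : Fin (2 * s)) (T B : CircularFence α), Even i.val → Odd j.val →
      T ∈ CircularFence.segment α i → T ∈ CircularFence.segment α (CircularFence.nextSeg i) →
      IsMax T →
      B ∈ CircularFence.segment α j → B ∈ CircularFence.segment α (CircularFence.nextSeg j) →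
      IsMin B →
      (∀ I : LowerSet (CircularFence α),
        CircularFence.redCount i I = CircularFence.redCount j I) →
      IsMesic (fun I => memStat T I + memStat B I) 1) ∧
    -- (4) all parts equal to two
    ((∀ i, α i = 2) →
      IsMesic (fun I : LowerSet (CircularFence α) => totalMaxStat I) (s : ℚ)) := by
  refine ⟨?_, ?_, ?_, fun hα => isMesic_of_sum_eq (sum_totalMaxStat hα)⟩
  · intro i x y hx hy hxs hys
    obtain ⟨k, hk, hka, rfl⟩ := exists_eq_chain_of_not_isShared hx hxs
    obtain ⟨l, hl, hla, rfl⟩ := exists_eq_chain_of_not_isShared hy hys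
    refine isMesic_of_sum_eq fun I => ?_
    rw [Finset.sum_sub_distrib, (isUnbranchedChain_chain i).sum_maxStat_eq hk hka hl hla I]
    ring
  · intro i x T B hx hxs hT hTmax hB hBmin
    obtain ⟨k, hk, hka, rfl⟩ := exists_eq_chain_of_not_isShared hx hxs
    rw [eq_chain_last_of_isMax hT hTmax, eq_chain_zero_of_isMin hB hBmin]
    refine isMesic_of_sum_eq fun I => ?_
    rw [Finset.sum_add_distrib, Finset.sum_add_distrib, ← Finset.mul_sum,
      (isUnbranchedChain_chain i).sum_maxStat_ends hk hka I, one_mul]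
  · intro i j T B hi hj hT _ hTmax hB _ hBmin hred
    -- Nodes are indexed by the segment they begin or lie inside, so a maximal node carries an odd
    -- index and cannot be indexed by the even `i`; dually for `B` below.
    have hTi : T = first α (nextSeg i) := hT.resolve_left fun h =>
      Nat.not_even_iff_odd.2 (odd_seg_of_isMax hTmax) (h ▸ hi)
    have hBj : B = first α (nextSeg j) := hB.resolve_left fun h =>
      Nat.not_even_iff_odd.2 hj (h ▸ even_seg_of_isMin hBmin)
    refine isMesic_of_sum_eq fun I => ?_
    have h : (redCount i I : ℚ) = redCount j I := by rw [hred I]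
    -- Here `h` becomes: the orbit sum of `χ̄_T` is the orbit size minus that of `χ̄_B`.
    rw [redCount_eq_sum, redCount_eq_sum, ← hTi, ← hBj, ← sum_rowOrbit_rowmotion (maxStat B),
      Finset.sum_congr rfl fun J _ => maxStat_of_isMax hTmax J,
      Finset.sum_congr rfl fun J _ => maxStat_rowmotion_of_isMin hBmin J,
      Finset.sum_sub_distrib, Finset.sum_const, nsmul_eq_mul] at h
    rw [Finset.sum_add_distrib]
    linarith
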